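/- Let $T\ge 0$, let $(\Omega,\mathcal F,(\mathcal F_t)_{t\in[0,T]},Q)$ be a filtered probability space ($Q$ is the pricing measure), let $B:[0,T]\to\mathbb R$ be a non-decreasing deterministic function with $B_0=1$ (the bond), and let $(X_t)_{t\in[0,T]}$ be a process with values in $[0,\infty)$ (the underlying asset). Let $\overline X_t=B_t^{-1}X_t$ be the discounted underlying asset, and assume that almost all of its paths are right-continuous. Let $f:[0,\infty)\to\mathbb R$ be such that $f(X_T)\in L^1(Q)$. For $t\in[0,T]$ the (discounted) values at time $t$ of the European and of the American option $f(X)$ with maturity $T$ are $$V_t^{f}=E_Q\big[B_T^{-1}f(X_T)\,\big|\,\mathcal F_t\big],\qquad V_t^{f,A}=\operatorname*{ess\,sup}_{\tau}\,E_Q\big[B_\tau^{-1}f(X_\tau)\,\big|\,\mathcal F_t\big],$$ where $\tau$ runs through all stopping times with values in $[t,T]$. Assume that $f$ is convex and that $\overline X$ is a submartingale with respect to $(\mathcal F_t)$ and $Q$. Suppose that the following two conditions hold: 1. $B_t=1$ for all $t\in[0,T]$, or $f(0)\le 0$; 2. $\overline X$ is a martingale, or $f'_+(0)\ge 0$, where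 $f'_+(0)\in[-\infty,\infty)$ is the right derivative of $f$ at $0$. Then for every $t\in[0,T]$ the random variables $B_\tau^{-1}f(X_\tau)$ are integrable for all stopping times $\tau$ with values in $[t,T]$, and $V_t^{f,A}=V_t^{f}$ almost surely. -/

import Mathlib

open MeasureTheory
open scoped NNReal

noncomputable section

/-- `V` is the essential supremum under `Q` of the (possibly uncountable) family `S` of random
variables: the almost surely smallest random variable dominating every member almost surely. -/
def IsEssSup {Ω : Type*} {m0 : MeasurableSpace Ω} (Q : Measure Ω) (S : Set (Ω → ℝ))
    (V : Ω → ℝ) : Prop :=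
  AEMeasurable V Q ∧ (∀ g ∈ S, g ≤ᵐ[Q] V) ∧
    ∀ W : Ω → ℝ, AEMeasurable W Q → (∀ g ∈ S, g ≤ᵐ[Q] W) → V ≤ᵐ[Q] W

/-- An essential supremum is unique up to almost sure equality. -/
theorem IsEssSup.ae_unique {Ω : Type*} {m0 : MeasurableSpace Ω} {Q : Measure Ω}
    {S : Set (Ω → ℝ)} {V W : Ω → ℝ} (hV : IsEssSup Q S V) (hW : IsEssSup Q S W) :
    V =ᵐ[Q] W :=
  (hV.2.2 W hW.1 hW.2.1).antisymm (hW.2.2 V hV.1 hV.2.1)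

/-- The discounted process `X̄ t = X t / B t` on the time interval `[0, T]`. -/
def discounted {Ω : Type*} {T : ℝ≥0} (B : Set.Iic T → ℝ) (X : Set.Iic T → Ω → ℝ) :
    Set.Iic T → Ω → ℝ :=
  fun s ω => (B s)⁻¹ * X s ω

/-- The admissible exercise times at time `t`: stopping times with values in `[t, T]`. -/
def exerciseTimes {Ω : Type*} {m0 : MeasurableSpace Ω} {T : ℝ≥0}
    (F : Filtration (Set.Iic T) m0) (t : Set.Iic T) : Set (Ω → Set.Iic T) :=
  {τ | IsStoppingTime F (fun ω => (τ ω : WithTop (Set.Iic T))) ∧ ∀ ω, t ≤ τ ω}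

/-- The discounted payoff `f(X_τ) / B_τ` obtained by exercising at the random time `τ`. -/
def discountedPayoff {Ω : Type*} {T : ℝ≥0} (B : Set.Iic T → ℝ) (X : Set.Iic T → Ω → ℝ)
    (f : ℝ → ℝ) (τ : Ω → Set.Iic T) : Ω → ℝ :=
  fun ω => (B (τ ω))⁻¹ * f (X (τ ω) ω)

/-- The (discounted) value at time `t` of the European option paying `f(X_T)` at maturity `T`
(the top element of the time interval): `E_Q[f(X_T) / B_T | F_t]`. -/
def europeanValue {Ω : Type*} {m0 : MeasurableSpace Ω} {T : ℝ≥0} (Q : Measure Ω)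
    (F : Filtration (Set.Iic T) m0) (B : Set.Iic T → ℝ) (X : Set.Iic T → Ω → ℝ)
    (f : ℝ → ℝ) (t : Set.Iic T) : Ω → ℝ :=
  Q[discountedPayoff B X f (fun _ => ⊤) | F t]

/-- `V` is (a version of) the discounted value at time `t` of the American option `f(X)` with
maturity `T`: all exercise payoffs are integrable, `V` is `F_t`-measurable, and `V` is the
essential supremum of `E_Q[f(X_τ) / B_τ | F_t]` over all stopping times `τ` in `[t, T]`. -/
def IsAmericanValue {Ω : Type*} {m0 : MeasurableSpace Ω} {T : ℝ≥0} (Q : Measure Ω)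
    (F : Filtration (Set.Iic T) m0) (B : Set.Iic T → ℝ) (X : Set.Iic T → Ω → ℝ)
    (f : ℝ → ℝ) (t : Set.Iic T) (V : Ω → ℝ) : Prop :=
  (∀ τ ∈ exerciseTimes F t, Integrable (discountedPayoff B X f τ) Q) ∧
  Measurable[F t] V ∧
  IsEssSup Q {g | ∃ τ ∈ exerciseTimes F t, g = Q[discountedPayoff B X f τ | F t]} V

/-- The right derivative of `f` at `0` exists and is non-negative. Only values on `[0, ∞)` enter.
For a convex `f` the right derivative always exists in `[-∞, ∞)`, so the only convex functions
without a finite one have right derivative `-∞`. -/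
def RightDerivAtZeroNonneg (f : ℝ → ℝ) : Prop :=
  ∃ c : ℝ, 0 ≤ c ∧ HasDerivWithinAt f c (Set.Ici 0) 0

end

/-! Exercising at `T` is admissible, so it suffices that no stopping time `τ ≥ t` beats it. Let `Y`
be the discounted asset, `b = B_τ`, and let `G ⊇ F t` be a σ-algebra of the information at `τ`.
Optional sampling gives `Y_τ ≤ E[Y_T | G]`, with equality for a martingale, so by condition 2 `f (b
Y_τ) ≤ f (b E[Y_T | G])`. As `b` is `G`-measurable, Jensen bounds this by `E[f (b Y_T) | G]`.
Condition 1 gives `b⁻¹ f (b Y_T) ≤ B_T⁻¹ f (X_T)`, because `f` is convex with `f 0 ≤ 0` or because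
both factors are `1`. Conditioning on `F t` finishes the proof.

The filtration need not satisfy the usual conditions and `f` may jump at `0`. Hence `G` is the
intersection of the σ-algebras of dyadic times decreasing to `τ` (`exists_sampled_le_condExp`), and
Jensen treats the end point separately (`map_condExp_le_of_nonneg`). -/

/-! ### Convex functions on `[0, ∞)` and conditional Jensen -/

/-- The supporting line of a convex function on `[0, ∞)` at an interior point, with slope the
right derivative, lies below the function. -/
theorem ConvexOn.add_rightDeriv_mul_le {f : ℝ → ℝ} (hf : ConvexOn ℝ (Set.Ici 0) f) {q z : ℝ}
    (hq : 0 < q) (hz : 0 ≤ z) : f q + derivWithin f (Set.Ioi q) q * (z - q) ≤ f z := by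
  have hqi : q ∈ interior (Set.Ici (0 : ℝ)) := by simpa using hq
  rcases lt_trichotomy q z with h | rfl | h
  · have := hf.rightDeriv_le_slope_of_mem_interior hqi (Set.mem_Ici.2 hz) h
    rw [slope_def_field, le_div_iff₀ (by linarith)] at this
    linarith
  · simp
  · have := (hf.slope_le_leftDeriv_of_mem_interior (Set.mem_Ici.2 hz) hqi h).trans
      (hf.leftDeriv_le_rightDeriv_of_mem_interior hqi)
    rw [slope_def_field, div_le_iff₀ (by linarith)] at this
    linarith

open Filter Topology in
/-- At an interior point, a convex function is the limit of its supporting lines from the right;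
so it lies below every bound for the supporting lines at rational points. -/
theorem ConvexOn.le_of_forall_rat_supporting_le {f : ℝ → ℝ} (hf : ConvexOn ℝ (Set.Ici 0) f)
    {z a : ℝ} (hz : 0 < z)
    (h : ∀ q : ℚ, 0 < (q : ℝ) → f q + derivWithin f (Set.Ioi (q : ℝ)) q * (z - q) ≤ a) :
    f z ≤ a := by
  -- For `q` in `(z, z + 1)` the slopes are at most `M`; since `z - q < 0`, the line with slope `M`
  -- stays below the supporting line.
  set M := derivWithin f (Set.Ioi (z + 1)) (z + 1)
  have hcont : ContinuousAt f z := by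
    have := hf.continuousOn_interior
    rw [interior_Ici] at this
    exact this.continuousAt (Ioi_mem_nhds hz)
  have hlim : Tendsto (fun q => f q + M * (z - q)) (𝓝[>] z) (𝓝 (f z)) := by
    have h1 : Tendsto (fun q => f q + M * (z - q)) (𝓝 z) (𝓝 (f z + M * (z - z))) :=
      hcont.add (by fun_prop : ContinuousAt (fun q => M * (z - q)) z)
    simpa using h1.mono_left nhdsWithin_le_nhds
  have hfreq : ∃ᶠ q in 𝓝[>] z, f q + M * (z - q) ≤ a := by
    rw [frequently_iff]
    intro U hU
    obtain ⟨u, hu, hU⟩ := (mem_nhdsGT_iff_exists_Ioo_subset).1 hU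
    obtain ⟨q, hq1, hq2⟩ := exists_rat_btwn (lt_min (Set.mem_Ioi.1 hu) (lt_add_one z))
    have hq0 : 0 < (q : ℝ) := hz.trans hq1
    refine ⟨q, hU ⟨hq1, hq2.trans_le (min_le_left _ _)⟩, le_trans ?_ (h q hq0)⟩
    have hle : derivWithin f (Set.Ioi (q : ℝ)) q ≤ M :=
      hf.monotoneOn_rightDeriv (by simpa using hq0) (by simp; linarith)
        (hq2.le.trans (min_le_right _ _))
    nlinarith
  exact le_of_tendsto_of_frequently hlim hfreq

/-- If the right derivative at `0` is non-negative, a convex function on `[0, ∞)` is monotone. -/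
theorem ConvexOn.monotoneOn_of_rightDerivAtZeroNonneg {f : ℝ → ℝ}
    (hf : ConvexOn ℝ (Set.Ici 0) f) (h : RightDerivAtZeroNonneg f) :
    MonotoneOn f (Set.Ici 0) := by
  obtain ⟨c, hc, hd⟩ := h
  have h0 : ∀ y : ℝ, 0 ≤ y → f 0 ≤ f y := by
    intro y hy
    rcases hy.eq_or_lt with rfl | hy
    · rfl
    have := hc.trans (hf.le_slope_of_hasDerivWithinAt (Set.mem_Ici.2 le_rfl)
      (Set.mem_Ici.2 hy.le) hy hd)
    rw [slope_def_field, le_div_iff₀ (by linarith)] at this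
    linarith
  intro x hx y hy hxy
  rcases hxy.eq_or_lt with rfl | hxy
  · rfl
  simp only [Set.mem_Ici] at hx hy
  have hy' : 0 < y := hx.trans_lt hxy
  have h1 : 0 ≤ 1 - x / y := by rw [sub_nonneg, div_le_one hy']; exact hxy.le
  have := hf.2 (Set.mem_Ici.2 le_rfl) (Set.mem_Ici.2 hy) h1 (div_nonneg hx hy)
    (sub_add_cancel 1 (x / y))
  have e : x / y * y = x := by field_simp
  simp only [smul_eq_mul, mul_zero, zero_add, e] at this
  nlinarith [h0 y hy]

/-- For a convex `f` with `f 0 ≤ 0`, the scaled payoff `b⁻¹ * f (b * y)` is monotone in `b`. -/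
theorem ConvexOn.inv_mul_comp_mul_le {f : ℝ → ℝ} (hf : ConvexOn ℝ (Set.Ici 0) f) (h0 : f 0 ≤ 0)
    {b c y : ℝ} (hb : 0 < b) (hbc : b ≤ c) (hy : 0 ≤ y) :
    b⁻¹ * f (b * y) ≤ c⁻¹ * f (c * y) := by
  have hc : 0 < c := hb.trans_le hbc
  have h1 : 0 ≤ 1 - b / c := by rw [sub_nonneg, div_le_one hc]; exact hbc
  have := hf.2 (Set.mem_Ici.2 le_rfl) (Set.mem_Ici.2 (mul_nonneg hc.le hy)) h1
    (div_nonneg hb.le hc.le) (sub_add_cancel 1 (b / c))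
  have e : b / c * (c * y) = b * y := by field_simp
  simp only [smul_eq_mul, mul_zero, zero_add, e] at this
  have h2 : f (b * y) ≤ b / c * f (c * y) := by nlinarith
  calc b⁻¹ * f (b * y) ≤ b⁻¹ * (b / c * f (c * y)) := by gcongr
    _ = c⁻¹ * f (c * y) := by field_simp

/-- Convexity gives continuity only on `(0, ∞)`; clipping makes the function constant on the rest.
-/
theorem ConvexOn.measurable_comp_max_zero {f : ℝ → ℝ} (hf : ConvexOn ℝ (Set.Ici 0) f) :
    Measurable fun x => f (max x 0) := by
  classical
  have hc : ContinuousOn f (Set.Ioi 0) := by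
    simpa using hf.continuousOn_interior
  have : (fun x => f (max x 0)) = (Set.Ioi (0 : ℝ)).piecewise f (fun _ => f 0) := by
    ext x
    by_cases hx : 0 < x
    · rw [Set.piecewise_eq_of_mem _ _ _ (Set.mem_Ioi.2 hx), max_eq_left hx.le]
    · rw [Set.piecewise_eq_of_notMem _ _ _ (by simpa using hx), max_eq_right (not_lt.1 hx)]
  rw [this]
  exact hc.measurable_piecewise continuousOn_const measurableSet_Ioi

/-- Conditional Jensen inequality for a convex function on `[0, ∞)`, without any
semicontinuity at the end point `0`. -/
theorem ConvexOn.map_condExp_le_of_nonneg {Ω : Type*} {m m0 : MeasurableSpace Ω} {Q : Measure Ω}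
    [IsFiniteMeasure Q] (hm : m ≤ m0) {f : ℝ → ℝ} (hf : ConvexOn ℝ (Set.Ici 0) f) {U : Ω → ℝ}
    (hU0 : 0 ≤ᵐ[Q] U) (hU : Integrable U Q) (hfU : Integrable (fun ω => f (U ω)) Q) :
    (fun ω => f ((Q[U | m]) ω)) ≤ᵐ[Q] Q[fun ω => f (U ω) | m] := by
  have hW0 : 0 ≤ᵐ[Q] Q[U | m] := condExp_nonneg hU0
  have hline : ∀ᵐ ω ∂Q, ∀ q : ℚ, 0 < (q : ℝ) →
      f q + derivWithin f (Set.Ioi (q : ℝ)) q * ((Q[U | m]) ω - q)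
        ≤ (Q[fun ω => f (U ω) | m]) ω := by
    rw [ae_all_iff]
    intro q
    by_cases hq : 0 < (q : ℝ)
    swap
    · exact ae_of_all _ fun _ h => absurd h hq
    set c := derivWithin f (Set.Ioi (q : ℝ)) q
    have hle : ((fun _ => f q - c * q) + c • U) ≤ᵐ[Q] fun ω => f (U ω) := by
      filter_upwards [hU0] with ω hω
      have := hf.add_rightDeriv_mul_le hq hω
      simp only [Pi.add_apply, Pi.smul_apply, smul_eq_mul]
      linarith
    have hmono := condExp_mono (m := m) ((integrable_const _).add (hU.smul c)) hfU hle
    filter_upwards [hmono, condExp_add (integrable_const (f q - c * q)) (hU.smul c) m,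
      condExp_smul c U m (μ := Q)] with ω h1 h2 h3 _
    rw [h2, Pi.add_apply, h3, condExp_const hm] at h1
    simp only [Pi.smul_apply, smul_eq_mul] at h1
    linarith
  -- Supporting lines at `q > 0` do not see a jump at `0`. But `U ≥ 0` has integral zero over `A`,
  -- so `U = 0` there and both sides equal `f 0`.
  set A : Set Ω := {ω | (Q[U | m]) ω = 0}
  have hA : MeasurableSet[m] A := stronglyMeasurable_condExp.measurable (measurableSet_singleton 0)
  have hUA : A.indicator U =ᵐ[Q] 0 := by
    have hn : 0 ≤ᵐ[Q] A.indicator U := by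
      filter_upwards [hU0] with ω hω
      exact Set.indicator_apply_nonneg fun _ => hω
    refine (integral_eq_zero_iff_of_nonneg_ae hn (hU.indicator (hm _ hA))).1 ?_
    rw [integral_indicator (hm _ hA), ← setIntegral_condExp hm hU hA]
    exact setIntegral_eq_zero_of_forall_eq_zero fun ω hω => hω
  have hfA : A.indicator (fun ω => f (U ω)) =ᵐ[Q] A.indicator fun _ => f 0 := by
    filter_upwards [hUA] with ω hω
    by_cases h : ω ∈ A
    · rw [Set.indicator_of_mem h] at hω ⊢
      rw [Set.indicator_of_mem h, hω]
      rfl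
    · simp [h]
  have hEA : A.indicator (Q[fun ω => f (U ω) | m]) =ᵐ[Q] A.indicator fun _ => f 0 := by
    refine (condExp_indicator hfU hA).symm.trans ((condExp_congr_ae hfA).trans ?_)
    rw [condExp_of_stronglyMeasurable hm (stronglyMeasurable_const.indicator hA)
      ((integrable_const _).indicator (hm _ hA))]
  filter_upwards [hW0, hline, hEA] with ω h0 h1 h2
  by_cases hω : ω ∈ A
  · rw [Set.indicator_of_mem hω, Set.indicator_of_mem hω] at h2
    rw [h2, show (Q[U | m]) ω = 0 from hω]
  · exact hf.le_of_forall_rat_supporting_le (lt_of_le_of_ne h0 fun h => hω h.symm) h1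

/-! ### Dyadic approximation of stopping times -/

/-- The dyadic approximation from the right of level `n` of a time, capped at `T`. -/
noncomputable def dyadicAbove {T : ℝ≥0} (n : ℕ) (s : Set.Iic T) : Set.Iic T :=
  ⟨min T ((⌊2 ^ n * (s : ℝ≥0)⌋₊ + 1 : ℝ≥0) / 2 ^ n), Set.mem_Iic.2 (min_le_left _ _)⟩

theorem coe_dyadicAbove {T : ℝ≥0} (n : ℕ) (s : Set.Iic T) :
    (dyadicAbove n s : ℝ≥0) = min T ((⌊2 ^ n * (s : ℝ≥0)⌋₊ + 1 : ℝ≥0) / 2 ^ n) := rfl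

theorem le_dyadicAbove {T : ℝ≥0} (n : ℕ) (s : Set.Iic T) : s ≤ dyadicAbove n s := by
  rw [← Subtype.coe_le_coe, coe_dyadicAbove]
  refine le_min (Set.mem_Iic.1 s.2) ?_
  rw [le_div_iff₀ (by positivity), mul_comm]
  exact (Nat.lt_floor_add_one _).le

theorem dyadicAbove_antitone {T : ℝ≥0} (s : Set.Iic T) :
    Antitone fun n => dyadicAbove n s := by
  refine antitone_nat_of_succ_le fun n => ?_
  rw [← Subtype.coe_le_coe, coe_dyadicAbove, coe_dyadicAbove]
  refine min_le_min le_rfl ?_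
  rw [div_le_div_iff₀ (by positivity) (by positivity)]
  have h : ⌊2 ^ (n + 1) * (s : ℝ≥0)⌋₊ < 2 * ⌊2 ^ n * (s : ℝ≥0)⌋₊ + 2 := by
    rw [Nat.floor_lt (by positivity)]
    have := Nat.lt_floor_add_one (2 ^ n * (s : ℝ≥0))
    push_cast
    calc 2 ^ (n + 1) * (s : ℝ≥0) = 2 * (2 ^ n * s) := by ring
      _ < 2 * (⌊2 ^ n * (s : ℝ≥0)⌋₊ + 1) := by gcongr
      _ = _ := by ring
  have h' : ((⌊2 ^ (n + 1) * (s : ℝ≥0)⌋₊ : ℝ≥0) + 1) ≤ 2 * ⌊2 ^ n * (s : ℝ≥0)⌋₊ + 2 := by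
    exact_mod_cast h
  calc ((⌊2 ^ (n + 1) * (s : ℝ≥0)⌋₊ : ℝ≥0) + 1) * 2 ^ n
      ≤ (2 * ⌊2 ^ n * (s : ℝ≥0)⌋₊ + 2) * 2 ^ n := by gcongr
    _ = _ := by ring

theorem countable_range_dyadicAbove {T : ℝ≥0} (n : ℕ) :
    (Set.range (dyadicAbove (T := T) n)).Countable := by
  refine (Set.countable_range fun k : ℕ =>
    (⟨min T ((k + 1 : ℝ≥0) / 2 ^ n), Set.mem_Iic.2 (min_le_left _ _)⟩ : Set.Iic T)).mono ?_
  rintro _ ⟨s, rfl⟩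
  exact ⟨⌊2 ^ n * (s : ℝ≥0)⌋₊, rfl⟩

open Filter Topology in
theorem tendsto_dyadicAbove {T : ℝ≥0} (s : Set.Iic T) :
    Tendsto (fun n => dyadicAbove n s) atTop (𝓝[≥] s) := by
  refine tendsto_nhdsWithin_iff.2 ⟨?_, Eventually.of_forall fun n => le_dyadicAbove n s⟩
  rw [tendsto_subtype_rng]
  have hlim : Tendsto (fun n : ℕ => (s : ℝ≥0) + (1 / 2) ^ n) atTop (𝓝 (s : ℝ≥0)) := by
    have : Tendsto (fun n : ℕ => (1 / 2 : ℝ≥0) ^ n) atTop (𝓝 0) :=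
      NNReal.tendsto_pow_atTop_nhds_zero_of_lt_one (NNReal.half_lt_self one_ne_zero)
    simpa using tendsto_const_nhds.add this
  refine tendsto_of_tendsto_of_tendsto_of_le_of_le tendsto_const_nhds hlim
    (fun n => le_dyadicAbove n s) fun n => ?_
  refine (coe_dyadicAbove n s).trans_le ((min_le_right _ _).trans ?_)
  have := Nat.floor_le (a := 2 ^ n * (s : ℝ≥0)) (by positivity)
  rw [div_le_iff₀ (by positivity)]
  calc (⌊2 ^ n * (s : ℝ≥0)⌋₊ + 1 : ℝ≥0) ≤ 2 ^ n * s + 1 := by gcongr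
    _ = (s + (1 / 2) ^ n) * 2 ^ n := by
      rw [add_mul, ← mul_pow]; norm_num; ring

/-- The `+ 1` in the approximation makes the right side strict, so the event involves `u` only
before a dyadic time not exceeding `s`. At `s = ⊤` the cap would break this. -/
theorem dyadicAbove_le_iff {T : ℝ≥0} (n : ℕ) {s u : Set.Iic T} (hs : s ≠ ⊤) :
    dyadicAbove n u ≤ s ↔ (u : ℝ≥0) < ⌊2 ^ n * (s : ℝ≥0)⌋₊ / 2 ^ n := by
  have hs' : ¬ T ≤ s := fun h => hs (Subtype.ext (le_antisymm s.2 h))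
  rw [← Subtype.coe_le_coe, coe_dyadicAbove, min_le_iff, or_iff_right hs']
  rw [div_le_iff₀ (by positivity), lt_div_iff₀ (by positivity), mul_comm (s : ℝ≥0),
    mul_comm (u : ℝ≥0), ← Nat.floor_lt (by positivity), ← Nat.succ_le_iff,
    Nat.le_floor_iff (by positivity)]
  push_cast
  rfl

theorem MeasureTheory.IsStoppingTime.dyadicAbove {Ω : Type*} {m0 : MeasurableSpace Ω} {T : ℝ≥0}
    {F : Filtration (Set.Iic T) m0} {τ : Ω → Set.Iic T}
    (hτ : IsStoppingTime F fun ω => (τ ω : WithTop (Set.Iic T))) (n : ℕ) :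
    IsStoppingTime F fun ω => (dyadicAbove n (τ ω) : WithTop (Set.Iic T)) := by
  intro s
  by_cases hs : s = ⊤
  · subst hs
    convert MeasurableSet.univ
    ext ω
    simp
  set r : ℝ≥0 := ⌊2 ^ n * (s : ℝ≥0)⌋₊ / 2 ^ n
  have hr : r ≤ s := by
    rw [div_le_iff₀ (by positivity), mul_comm]
    exact Nat.floor_le (by positivity)
  have := hτ.measurableSet_lt_le (i := ⟨r, hr.trans s.2⟩) (j := s) hr
  convert this using 1
  ext ω
  simp only [Set.mem_ofPred_eq, WithTop.coe_le_coe, WithTop.coe_lt_coe]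
  exact dyadicAbove_le_iff n hs

/-! ### Optional sampling -/

/-- A stopping time is measurable for its own σ-algebra, as a map into the index set. -/
theorem MeasureTheory.IsStoppingTime.measurable_of_coe {Ω : Type*} {m0 : MeasurableSpace Ω}
    {T : ℝ≥0} {F : Filtration (Set.Iic T) m0} {τ : Ω → Set.Iic T}
    (hτ : IsStoppingTime F fun ω => (τ ω : WithTop (Set.Iic T))) :
    Measurable[hτ.measurableSpace] τ := by
  refine measurable_of_Iic fun i => ?_
  convert hτ.measurableSet_le' i using 1
  ext ω
  simp

/-- An adapted process sampled at a stopping time with countable range is measurable for the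
σ-algebra of the stopping time. -/
theorem MeasureTheory.StronglyAdapted.measurable_sampled_of_countable_range {Ω : Type*}
    {m0 : MeasurableSpace Ω} {T : ℝ≥0} {F : Filtration (Set.Iic T) m0} {Y : Set.Iic T → Ω → ℝ}
    (hY : StronglyAdapted F Y) {σ : Ω → Set.Iic T}
    (hσ : IsStoppingTime F fun ω => (σ ω : WithTop (Set.Iic T))) (hc : (Set.range σ).Countable) :
    Measurable[hσ.measurableSpace] fun ω => Y (σ ω) ω := by
  intro A hA
  have : (fun ω => Y (σ ω) ω) ⁻¹' A = ⋃ i ∈ Set.range σ,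
      (Y i ⁻¹' A ∩ {ω | (σ ω : WithTop (Set.Iic T)) = i}) := by
    ext ω
    simp only [Set.mem_preimage, Set.mem_iUnion, Set.mem_inter_iff, Set.mem_ofPred_eq,
      WithTop.coe_inj]
    exact ⟨fun h => ⟨σ ω, ⟨ω, rfl⟩, h, rfl⟩, fun ⟨_, _, h, e⟩ => e ▸ h⟩
  rw [this]
  refine MeasurableSet.biUnion hc fun i _ => ?_
  rw [hσ.measurableSet_inter_eq_iff]
  exact ((hY i).measurable hA).inter (hσ.measurableSet_eq i)

/-- Optional sampling for a stopping time with countable range. -/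
theorem MeasureTheory.Submartingale.sampled_le_condExp_of_countable_range {Ω : Type*}
    {m0 : MeasurableSpace Ω} {Q : Measure Ω} [IsFiniteMeasure Q] {T : ℝ≥0}
    {F : Filtration (Set.Iic T) m0} {Y : Set.Iic T → Ω → ℝ}
    (hY : Submartingale Y F Q) {σ : Ω → Set.Iic T}
    (hσ : IsStoppingTime F fun ω => (σ ω : WithTop (Set.Iic T))) (hc : (Set.range σ).Countable) :
    (fun ω => Y (σ ω) ω) ≤ᵐ[Q] Q[Y ⊤ | hσ.measurableSpace] := by
  have h : ∀ᵐ ω ∂Q, ∀ i ∈ Set.range σ, (σ ω : WithTop (Set.Iic T)) = i →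
      Y i ω ≤ (Q[Y ⊤ | hσ.measurableSpace]) ω := by
    rw [ae_ball_iff hc]
    intro i _
    have h1 := condExp_stopping_time_ae_eq_restrict_eq (μ := Q) (f := Y ⊤) hσ i
    rw [Filter.EventuallyEq, ae_restrict_iff' (F.le _ _ (hσ.measurableSet_eq i))] at h1
    filter_upwards [h1, hY.2.1 i ⊤ le_top] with ω h1 h2 h3
    rw [h1 h3]
    exact h2
  filter_upwards [h] with ω hω
  exact hω _ ⟨ω, rfl⟩ rfl

/-- Both `Y` and `-Y` are submartingales. -/
theorem MeasureTheory.Martingale.sampled_eq_condExp_of_countable_range {Ω : Type*}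
    {m0 : MeasurableSpace Ω} {Q : Measure Ω} [IsFiniteMeasure Q] {T : ℝ≥0}
    {F : Filtration (Set.Iic T) m0} {Y : Set.Iic T → Ω → ℝ}
    (hY : Martingale Y F Q) {σ : Ω → Set.Iic T}
    (hσ : IsStoppingTime F fun ω => (σ ω : WithTop (Set.Iic T))) (hc : (Set.range σ).Countable) :
    (fun ω => Y (σ ω) ω) =ᵐ[Q] Q[Y ⊤ | hσ.measurableSpace] := by
  refine (hY.submartingale.sampled_le_condExp_of_countable_range hσ hc).antisymm ?_
  filter_upwards [hY.neg.submartingale.sampled_le_condExp_of_countable_range hσ hc,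
    condExp_neg (μ := Q) (Y ⊤) hσ.measurableSpace] with ω h1 h2
  rw [show (-Y) ⊤ = -Y ⊤ from rfl, h2] at h1
  simpa using h1

open Filter Topology in
/-- If `D n → Z` in `L¹` and `Z` is `G`-measurable, then along a subsequence
`E[D n | G] → Z` almost surely. -/
theorem exists_subseq_condExp_tendsto_ae {Ω : Type*} {G m0 : MeasurableSpace Ω} {Q : Measure Ω}
    [IsFiniteMeasure Q] (hG : G ≤ m0) {D : ℕ → Ω → ℝ} {Z : Ω → ℝ} (hD : ∀ n, Integrable (D n) Q)
    (hZ : Integrable Z Q) (hZm : StronglyMeasurable[G] Z)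
    (h : Tendsto (fun n => eLpNorm (D n - Z) 1 Q) atTop (𝓝 0)) :
    ∃ ns : ℕ → ℕ, ∀ᵐ ω ∂Q, Tendsto (fun k => (Q[D (ns k) | G]) ω) atTop (𝓝 (Z ω)) := by
  have h1 : Tendsto (fun n => eLpNorm (Q[D n | G] - Z) 1 Q) atTop (𝓝 0) := by
    refine tendsto_of_tendsto_of_tendsto_of_le_of_le tendsto_const_nhds h
      (fun _ => zero_le) fun n => ?_
    refine le_trans (le_of_eq (eLpNorm_congr_ae ?_)) (eLpNorm_condExp_le_eLpNorm (m := G) _ le_rfl)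
    filter_upwards [condExp_sub (hD n) hZ G] with ω hω
    rw [hω, condExp_of_stronglyMeasurable hG hZm hZ]
  obtain ⟨ns, -, hns⟩ := (tendstoInMeasure_of_tendsto_eLpNorm one_ne_zero
    (fun n => integrable_condExp.aestronglyMeasurable) hZ.aestronglyMeasurable
    h1).exists_seq_tendsto_ae
  exact ⟨ns, hns⟩

open Filter Topology in
/-- Optional sampling at the terminal time for a non-negative submartingale with almost surely
right-continuous paths. As the filtration need be neither right-continuous nor complete, the
sampled value is only almost surely equal to a random variable measurable for a suitable
σ-algebra `G`, for which `τ` is measurable. -/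
theorem MeasureTheory.Submartingale.exists_sampled_le_condExp {Ω : Type*}
    {m0 : MeasurableSpace Ω} {Q : Measure Ω} [IsFiniteMeasure Q] {T : ℝ≥0}
    {F : Filtration (Set.Iic T) m0} {Y : Set.Iic T → Ω → ℝ} (hY : Submartingale Y F Q)
    (hY0 : ∀ s ω, 0 ≤ Y s ω)
    (hrc : ∀ᵐ ω ∂Q, ∀ s, ContinuousWithinAt (fun u => Y u ω) (Set.Ici s) s)
    {t : Set.Iic T} {τ : Ω → Set.Iic T}
    (hτ : IsStoppingTime F fun ω => (τ ω : WithTop (Set.Iic T))) (ht : ∀ ω, t ≤ τ ω) :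
    ∃ (G : MeasurableSpace Ω) (Z : Ω → ℝ), G ≤ m0 ∧ F t ≤ G ∧ Measurable[G] τ ∧
      StronglyMeasurable[G] Z ∧ Integrable Z Q ∧ (fun ω => Y (τ ω) ω) =ᵐ[Q] Z ∧
      Z ≤ᵐ[Q] Q[Y ⊤ | G] ∧ (Martingale Y F Q → Z =ᵐ[Q] Q[Y ⊤ | G]) := by
  have hσ := fun n => hτ.dyadicAbove n
  have hc : ∀ n, (Set.range fun ω => dyadicAbove n (τ ω)).Countable := fun n =>
    (countable_range_dyadicAbove n).mono (Set.range_comp_subset_range τ (dyadicAbove n))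
  set H : ℕ → MeasurableSpace Ω := fun n => (hσ n).measurableSpace
  have hHm : ∀ n, H n ≤ m0 := fun n => (hσ n).measurableSpace_le
  have hHanti : Antitone H := fun k n hkn => (hσ n).measurableSpace_mono (hσ k) fun ω =>
    WithTop.coe_le_coe.2 (dyadicAbove_antitone (τ ω) hkn)
  set D : ℕ → Ω → ℝ := fun n ω => Y (dyadicAbove n (τ ω)) ω
  have hDm : ∀ n, Measurable[H n] (D n) := fun n =>
    hY.1.measurable_sampled_of_countable_range (hσ n) (hc n)
  have hDle : ∀ n, D n ≤ᵐ[Q] Q[Y ⊤ | H n] := fun n =>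
    hY.sampled_le_condExp_of_countable_range (hσ n) (hc n)
  have hD0 : ∀ n ω, 0 ≤ D n ω := fun n ω => hY0 _ _
  have hDnorm : ∀ n, ∀ᵐ ω ∂Q, ‖D n ω‖ ≤ ‖(Q[Y ⊤ | H n]) ω‖ := fun n => by
    filter_upwards [hDle n] with ω hω
    rw [Real.norm_of_nonneg (hD0 n ω), Real.norm_of_nonneg ((hD0 n ω).trans hω)]
    exact hω
  have hDas : ∀ n, AEStronglyMeasurable (D n) Q := fun n =>
    ((hDm n).mono (hHm n) le_rfl).aestronglyMeasurable
  have hDint : ∀ n, Integrable (D n) Q := fun n => integrable_condExp.mono (hDas n) (hDnorm n)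
  have hUI0 := (hY.integrable ⊤).uniformIntegrable_condExp (ℱ := H) hHm
  -- By non-negativity `D n` is dominated by conditional expectations of the single variable `Y ⊤`,
  -- which are uniformly integrable.
  have hUI : UniformIntegrable D 1 Q := by
    refine ⟨hDas, fun ε hε => ?_, ?_⟩
    · obtain ⟨δ, hδ, h⟩ := hUI0.2.1 hε
      refine ⟨δ, hδ, fun n s hs hQs => (eLpNorm_mono_ae ?_).trans (h n s hs hQs)⟩
      filter_upwards [hDnorm n] with ω hω
      by_cases hωs : ω ∈ s <;> simp [hωs, -Real.norm_eq_abs, hω]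
    · obtain ⟨C, hC⟩ := hUI0.2.2
      exact ⟨C, fun n => (eLpNorm_mono_ae (hDnorm n)).trans (hC n)⟩
  set G : MeasurableSpace Ω := ⨅ n, H n with hGdef
  have hGH : ∀ n, G ≤ H n := fun n => iInf_le _ n
  have hGm : G ≤ m0 := (hGH 0).trans (hHm 0)
  -- A liminf ignores finitely many terms, so it is measurable for every `H k`, hence for `G`.
  set Z : Ω → ℝ := fun ω => liminf (fun n => D n ω) atTop
  have hZm : Measurable[G] Z := by
    intro A hA
    rw [hGdef, MeasurableSpace.measurableSet_iInf]
    intro k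
    have hZk : Z = fun ω => liminf (fun n => D (n + k) ω) atTop := by
      ext ω
      exact (liminf_nat_add (fun n => D n ω) k).symm
    rw [hZk]
    exact Measurable.liminf (mδ := H k)
      (fun n => (hDm (n + k)).mono (hHanti (Nat.le_add_left k n)) le_rfl) hA
  have hlimY : ∀ᵐ ω ∂Q, Tendsto (fun n => D n ω) atTop (𝓝 (Y (τ ω) ω)) := by
    filter_upwards [hrc] with ω hω
    exact (hω (τ ω)).tendsto.comp (tendsto_dyadicAbove (τ ω))
  have hYZ : (fun ω => Y (τ ω) ω) =ᵐ[Q] Z := by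
    filter_upwards [hlimY] with ω hω
    exact hω.liminf_eq.symm
  have hlim : ∀ᵐ ω ∂Q, Tendsto (fun n => D n ω) atTop (𝓝 (Z ω)) := by
    filter_upwards [hlimY, hYZ] with ω h1 h2
    rwa [← h2]
  have hZint : Integrable Z Q := memLp_one_iff_integrable.1 (hUI.memLp_of_ae_tendsto hlim)
  have hL1 : Tendsto (fun n => eLpNorm (D n - Z) 1 Q) atTop (𝓝 0) :=
    tendsto_Lp_finite_of_tendsto_ae le_rfl ENNReal.one_ne_top hDas
      (memLp_one_iff_integrable.2 hZint) hUI.2.1 hlim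
  obtain ⟨ns, hns⟩ := exists_subseq_condExp_tendsto_ae hGm hDint hZint hZm.stronglyMeasurable hL1
  have htower : ∀ n, Q[Q[Y ⊤ | H n] | G] =ᵐ[Q] Q[Y ⊤ | G] := fun n =>
    condExp_condExp_of_le (hGH n) (hHm n)
  refine ⟨G, Z, hGm, le_iInf fun n => ?_, ?_, hZm.stronglyMeasurable, hZint, hYZ, ?_, fun hM => ?_⟩
  · exact (hσ n).le_measurableSpace_of_const_le fun ω =>
      WithTop.coe_le_coe.2 ((ht ω).trans (le_dyadicAbove n (τ ω)))
  · refine hτ.measurable_of_coe.mono (le_iInf fun n => ?_) le_rfl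
    exact hτ.measurableSpace_mono (hσ n) fun ω => WithTop.coe_le_coe.2 (le_dyadicAbove n (τ ω))
  · have hle : ∀ᵐ ω ∂Q, ∀ n, (Q[D n | G]) ω ≤ (Q[Y ⊤ | G]) ω := ae_all_iff.2 fun n => by
      filter_upwards [condExp_mono (m := G) (hDint n) integrable_condExp (hDle n), htower n]
        with ω h1 h2
      exact h1.trans h2.le
    filter_upwards [hle, hns] with ω h1 h2
    exact le_of_tendsto' h2 fun k => h1 _
  · have heq : ∀ᵐ ω ∂Q, ∀ n, (Q[D n | G]) ω = (Q[Y ⊤ | G]) ω := ae_all_iff.2 fun n =>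
      (condExp_congr_ae (hM.sampled_eq_condExp_of_countable_range (hσ n) (hc n))).trans (htower n)
    filter_upwards [heq, hns] with ω h1 h2
    simp only [h1] at h2
    exact tendsto_nhds_unique h2 tendsto_const_nhds

/-! ### Comparison of early exercise with maturity -/

/-- Exercising at a stopping time `τ ≥ t` yields an integrable discounted payoff, whose
conditional expectation is dominated by the value of the European option. -/
theorem discountedPayoff_integrable_and_condExp_le {Ω : Type*} {m0 : MeasurableSpace Ω}
    {Q : Measure Ω} [IsProbabilityMeasure Q] {T : ℝ≥0} {F : Filtration (Set.Iic T) m0}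
    {B : Set.Iic T → ℝ} (hB : Monotone B) (hB0 : B ⊥ = 1)
    {X : Set.Iic T → Ω → ℝ} (hX : ∀ s ω, 0 ≤ X s ω)
    (hrc : ∀ᵐ ω ∂Q, ∀ s : Set.Iic T,
      ContinuousWithinAt (fun u => discounted B X u ω) (Set.Ici s) s)
    (hsub : Submartingale (discounted B X) F Q)
    {f : ℝ → ℝ} (hf : ConvexOn ℝ (Set.Ici 0) f)
    (hint : Integrable (fun ω => f (X ⊤ ω)) Q)
    (h1 : (∀ s, B s = 1) ∨ f 0 ≤ 0)
    (h2 : Martingale (discounted B X) F Q ∨ RightDerivAtZeroNonneg f)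
    {t : Set.Iic T} {τ : Ω → Set.Iic T} (hτ : τ ∈ exerciseTimes F t) :
    Integrable (discountedPayoff B X f τ) Q ∧
      Q[discountedPayoff B X f τ | F t] ≤ᵐ[Q] europeanValue Q F B X f t := by
  have hB1 : ∀ s, 1 ≤ B s := fun s => hB0.symm.le.trans (hB bot_le)
  have hBpos : ∀ s, 0 < B s := fun s => one_pos.trans_le (hB1 s)
  set Y := discounted B X
  have hY0 : ∀ s ω, 0 ≤ Y s ω := fun s ω =>
    mul_nonneg (inv_nonneg.2 (hBpos s).le) (hX s ω)
  have hXY : ∀ s ω, X s ω = B s * Y s ω := fun s ω => (mul_inv_cancel_left₀ (hBpos s).ne' _).symm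
  have haes : ∀ V : Ω → ℝ, AEStronglyMeasurable V Q → 0 ≤ᵐ[Q] V →
      AEStronglyMeasurable (fun ω => f (V ω)) Q := fun V hV hV0 => by
    refine (hf.measurable_comp_max_zero.comp_aemeasurable
      hV.aemeasurable).aestronglyMeasurable.congr ?_
    filter_upwards [hV0] with ω hω
    exact congrArg f (max_eq_left hω)
  obtain ⟨G, Z, hG, hFG, hτG, hZm, hZ, hYZ, hZle, hZeq⟩ :=
    hsub.exists_sampled_le_condExp hY0 hrc hτ.1 hτ.2
  set W := Q[Y ⊤ | G]
  set b : Ω → ℝ := fun ω => B (τ ω) with hb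
  have hb1 : ∀ ω, 1 ≤ b ω := fun ω => hB1 _
  have hbpos : ∀ ω, 0 < b ω := fun ω => hBpos _
  have hbG : Measurable[G] b := hB.measurable.comp hτG
  have hbm : Measurable[m0] b := hbG.mono hG le_rfl
  have hbound : ∀ ω, ‖b ω‖ ≤ B ⊤ := fun ω => by
    rw [Real.norm_of_nonneg (hbpos ω).le]
    exact hB le_top
  have hbinv : ∀ ω, ‖(b ω)⁻¹‖ ≤ 1 := fun ω => by
    rw [Real.norm_of_nonneg (inv_nonneg.2 (hbpos ω).le)]
    exact inv_le_one_of_one_le₀ (hb1 ω)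
  have hYint : Integrable (Y ⊤) Q := hsub.integrable ⊤
  -- The bond is frozen at `τ` while the discounted asset runs on to `T`; this separates Jensen from
  -- the change of discount factor.
  set U : Ω → ℝ := fun ω => b ω * Y ⊤ ω with hU
  have hUint : Integrable U Q := hYint.bdd_mul hbm.aestronglyMeasurable (ae_of_all _ hbound)
  have hU0 : ∀ ω, 0 ≤ U ω := fun ω => mul_nonneg (hbpos ω).le (hY0 _ _)
  have hZ0 : 0 ≤ᵐ[Q] Z := by
    filter_upwards [hYZ] with ω hω
    rw [← hω]
    exact hY0 _ _
  -- The supporting line at `1` serves as an integrable lower bound.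
  set c := derivWithin f (Set.Ioi 1) 1
  have hmin : ∀ z, 0 ≤ z → (f 1 - c) + c * z ≤ f z := fun z hz => by
    have := hf.add_rightDeriv_mul_le one_pos hz
    linarith
  set E : Ω → ℝ := discountedPayoff B X f fun _ => ⊤ with hE
  have hEint : Integrable E Q := hint.const_mul _
  have hscale : ∀ ω, (b ω)⁻¹ * f (U ω) ≤ E ω := fun ω => by
    simp only [hE, discountedPayoff, hXY, hU, hb]
    rcases h1 with h | h
    · simp [h]
    · exact hf.inv_mul_comp_mul_le h (hBpos _) (hB le_top) (hY0 _ _)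
  have hfU : Integrable (fun ω => f (U ω)) Q := by
    have hlo : Integrable (fun ω => (f 1 - c) + c * U ω) Q :=
      (integrable_const _).add (hUint.const_mul c)
    have hup : Integrable (fun ω => b ω * E ω) Q :=
      hEint.bdd_mul hbm.aestronglyMeasurable (ae_of_all _ hbound)
    refine integrable_of_le_of_le (haes U hUint.1 (ae_of_all _ hU0))
      (ae_of_all _ fun ω => hmin _ (hU0 ω)) (ae_of_all _ fun ω => ?_) hlo hup
    have := mul_le_mul_of_nonneg_left (hscale ω) (hbpos ω).le
    rwa [mul_inv_cancel_left₀ (hbpos ω).ne'] at this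
  have hbinvG : StronglyMeasurable[G] fun ω => (b ω)⁻¹ := hbG.inv.stronglyMeasurable
  have hscaled : Integrable (fun ω => (b ω)⁻¹ * f (U ω)) Q :=
    hfU.bdd_mul (hbinvG.mono hG).aestronglyMeasurable (ae_of_all _ hbinv)
  have hpull1 : Q[U | G] =ᵐ[Q] fun ω => b ω * W ω :=
    condExp_mul_of_stronglyMeasurable_left hbG.stronglyMeasurable hUint hYint
  have hpull2 : Q[fun ω => (b ω)⁻¹ * f (U ω) | G] =ᵐ[Q]
      fun ω => (b ω)⁻¹ * (Q[fun ω => f (U ω) | G]) ω :=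
    condExp_mul_of_stronglyMeasurable_left hbinvG hscaled hfU
  have hfZW : ∀ᵐ ω ∂Q, f (b ω * Z ω) ≤ f (b ω * W ω) := by
    rcases h2 with h | h
    · filter_upwards [hZeq h] with ω hω
      rw [hω]
    · filter_upwards [hZle, hZ0] with ω hω h0
      have hbZ := mul_le_mul_of_nonneg_left hω (hbpos ω).le
      have hbZ0 := mul_nonneg (hbpos ω).le h0
      exact hf.monotoneOn_of_rightDerivAtZeroNonneg h hbZ0 (hbZ0.trans hbZ) hbZ
  have hpay : discountedPayoff B X f τ =ᵐ[Q] fun ω => (b ω)⁻¹ * f (b ω * Z ω) := by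
    filter_upwards [hYZ] with ω hω
    simp only [discountedPayoff, hXY, hb, ← hω]
  have hle : (fun ω => (b ω)⁻¹ * f (b ω * Z ω)) ≤ᵐ[Q] Q[E | G] := by
    filter_upwards [hfZW, hpull1, hpull2,
      hf.map_condExp_le_of_nonneg hG (ae_of_all _ hU0) hUint hfU,
      condExp_mono (m := G) hscaled hEint (ae_of_all _ hscale)] with ω e1 e2 e3 e4 e5
    rw [e2] at e4
    rw [e3] at e5
    exact (mul_le_mul_of_nonneg_left (e1.trans e4) (inv_nonneg.2 (hbpos ω).le)).trans e5
  -- The inequality `hle` itself is the upper bound; the lower one is the supporting line at `b Z`,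
  -- divided by `b`.
  have hpayint : Integrable (fun ω => (b ω)⁻¹ * f (b ω * Z ω)) Q := by
    have hlo : Integrable (fun ω => (b ω)⁻¹ * (f 1 - c) + c * Z ω) Q :=
      ((integrable_const _).bdd_mul (hbinvG.mono hG).aestronglyMeasurable
        (ae_of_all _ hbinv)).add (hZ.const_mul c)
    have hbZ0 : 0 ≤ᵐ[Q] fun ω => b ω * Z ω := by
      filter_upwards [hZ0] with ω h0
      exact mul_nonneg (hbpos ω).le h0
    refine integrable_of_le_of_le ((hbinvG.mono hG).aestronglyMeasurable.mul
      (haes _ (hbm.aestronglyMeasurable.mul hZ.1) hbZ0)) ?_ hle hlo integrable_condExp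
    filter_upwards [hbZ0] with ω h0
    have := mul_le_mul_of_nonneg_left (hmin _ h0) (inv_nonneg.2 (hbpos ω).le)
    refine le_trans (le_of_eq ?_) this
    field_simp [(hbpos ω).ne']
  refine ⟨hpayint.congr hpay.symm, ?_⟩
  calc Q[discountedPayoff B X f τ | F t]
      =ᵐ[Q] Q[fun ω => (b ω)⁻¹ * f (b ω * Z ω) | F t] := condExp_congr_ae hpay
    _ ≤ᵐ[Q] Q[Q[E | G] | F t] := condExp_mono hpayint integrable_condExp hle
    _ =ᵐ[Q] Q[E | F t] := condExp_condExp_of_le hFG hG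

theorem corollary1 {Ω : Type*} {m0 : MeasurableSpace Ω} (Q : Measure Ω) [IsProbabilityMeasure Q]
    (T : ℝ≥0) (F : Filtration (Set.Iic T) m0)
    (B : Set.Iic T → ℝ) (hB : Monotone B) (hB0 : B ⊥ = 1)
    (X : Set.Iic T → Ω → ℝ) (hX : ∀ s ω, 0 ≤ X s ω)
    (hrc : ∀ᵐ ω ∂Q, ∀ s : Set.Iic T,
      ContinuousWithinAt (fun u => discounted B X u ω) (Set.Ici s) s)
    (hsub : Submartingale (discounted B X) F Q)
    (f : ℝ → ℝ) (hf : ConvexOn ℝ (Set.Ici 0) f)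
    (hint : Integrable (fun ω => f (X ⊤ ω)) Q)
    (h1 : (∀ s, B s = 1) ∨ f 0 ≤ 0)
    (h2 : Martingale (discounted B X) F Q ∨ RightDerivAtZeroNonneg f)
    (t : Set.Iic T) :
    IsAmericanValue Q F B X f t (europeanValue Q F B X f t) := by
  have key := fun τ (hτ : τ ∈ exerciseTimes F t) =>
    discountedPayoff_integrable_and_condExp_le hB hB0 hX hrc hsub hf hint h1 h2 hτ
  refine ⟨fun τ hτ => (key τ hτ).1, stronglyMeasurable_condExp.measurable,
    integrable_condExp.aestronglyMeasurable.aemeasurable, ?_, fun W _ hW => ?_⟩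
  · rintro _ ⟨τ, hτ, rfl⟩
    exact (key τ hτ).2
  · exact hW _ ⟨fun _ => ⊤, ⟨isStoppingTime_const F ⊤, fun _ => le_top⟩, rfl⟩
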